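/- **Theorem (Leray type cohomology spectral sequence).** Let $\mathscr A$ be a complete abelian category with exact products. *Notation.* For a simplicial set $X$ let $\Delta/X$ be its simplex category: objects are the simplices of $X$, and morphisms $x\to x'$ are the morphisms $\theta$ of $\Delta$ with $x=X(\theta)(x')$. A map $f\colon X\to Y$ induces $\Delta/f\colon\Delta/X\to\Delta/Y$, $x\mapsto f(x)$. A Gabriel–Zisman natural system on $X$ is a functor $T\colon\Delta/X\to\mathscr A$. Its cohomology $H^n_{GZ}(X,T)$ is the $n$-th cohomology of the cochain complex $C^n_{GZ}(X,T)=\prod_{\sigma\in X_n}T(\sigma)$ with differential $\sum_{i=0}^{n+1}(-1)^i d^i$, where the component of $d^i$ at $\sigma\in X_{n+1}$ is the projection to $T(\sigma\circ\delta^i)$ followed by the morphism $T(\sigma\circ\delta^i)\to T(\sigma)$ induced by the coface map $\delta^i$. It is functorial: a map $\varphi\colon X'\to X$ and a natural transformation $\tau\colon T\circ\Delta/\varphi\to T'$ induce $H^n_{GZ}(X,T)\to H^n_{GZ}(X',T')$. Write $(\Delta/f)^*$ for precomposition with $\Delta/f$, and $(\Delta/f)_*=\mathrm{Ran}_{\Delta/f}$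 for right Kan extension along $\Delta/f$. A connected sequence of functors between abelian categories consists of additive functors $F^q$, $q\ge 0$, with connecting morphisms $F^q(C)\to F^{q+1}(A)$, natural in the short exact sequence $0\to A\to B\to C\to 0$, whose long sequences are complexes. It is universal if every natural transformation $F^0\to G^0$ to the degree $0$ part of a connected sequence $G$ extends uniquely to a morphism $F\to G$. The right satellites of a functor $F$ are the terms of a universal connected sequence with degree $0$ part $F$; they are unique up to unique isomorphism if they exist. *Claim.* For every map $f\colon X\to Y$ of simplicial sets the right satellites $R^q(\Delta/f)_*$, $q\ge 0$, of $(\Delta/f)_*$ exist, and for every Gabriel–Zisman natural system $T\colon\Delta/X\to\mathscr A$ there is a first quadrant cohomological spectral sequence $$E_2^{p,q}\cong H^p_{GZ}\bigl(Y,\,R^q(\Delta/f)_*(T)\bigr)\;\Longrightarrow\;H^{p+q}_{GZ}(X,T),$$ that is, $H^n=H^n_{GZ}(X,T)$ has a decreasing filtration $H^n=F^0\supseteq F^1\supseteq\dots\supseteq F^{n+1}=0$ with $F^p/F^{p+1}\cong E_\infty^{p,n-p}$ for $0\le p\le n$. The spectral sequence is natural in $f$ and $T$ in the following sense. A morphism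 $(f,T)\to(f',T')$ consists of maps $\varphi\colon X'\to X$ and $\psi\colon Y'\to Y$ with $f\varphi=\psi f'$ and a natural transformation $\tau\colon T\circ\Delta/\varphi\to T'$. Then the canonical base change transformation $(\Delta/\psi)^*(\Delta/f)_*\to(\Delta/f')_*(\Delta/\varphi)^*$ extends uniquely to a morphism of connected sequences $(\Delta/\psi)^*R^q(\Delta/f)_*\to R^q(\Delta/f')_*(\Delta/\varphi)^*$; the spectral sequence, the filtrations and the isomorphisms $F^p/F^{p+1}\cong E_\infty^{p,q}$ are functorial in $(f,T)$, the abutment carrying the maps $H^n_{GZ}(X,T)\to H^n_{GZ}(X',T')$ induced by $(\varphi,\tau)$; and the isomorphism for $E_2^{p,q}$ is natural with respect to the map $H^p_{GZ}(Y,R^q(\Delta/f)_*T)\to H^p_{GZ}(Y',R^q(\Delta/f')_*T')$ induced by $\psi$ and the composite $(\Delta/\psi)^*R^q(\Delta/f)_*T\to R^q(\Delta/f')_*(\Delta/\varphi)^*T\to R^q(\Delta/f')_*T'$. -/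

import Mathlib

open CategoryTheory CategoryTheory.Limits Opposite Simplicial

universe u v w

noncomputable section

/-! ### Connected sequences of functors and right satellites -/

namespace Homological

/-- A (covariant, nonnegatively graded) connected sequence of additive functors, also called a
cohomological `∂`-functor: additive functors `obj n` with connecting morphisms
`obj n S.X₃ ⟶ obj (n + 1) S.X₁`, natural in the short exact sequence `S`, such that the resulting
long sequences are complexes. -/
structure ConnectedSequence (C : Type*) [Category C] [Abelian C] (D : Type*) [Category D]
    [Abelian D] where
  obj (n : ℕ) : C ⥤ D
  additive (n : ℕ) : (obj n).Additive
  δ (n : ℕ) (S : ShortComplex C) (hS : S.ShortExact) : (obj n).obj S.X₃ ⟶ (obj (n + 1)).obj S.X₁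
  map_g_δ (n : ℕ) (S : ShortComplex C) (hS : S.ShortExact) : (obj n).map S.g ≫ δ n S hS = 0
  δ_map_f (n : ℕ) (S : ShortComplex C) (hS : S.ShortExact) :
    δ n S hS ≫ (obj (n + 1)).map S.f = 0
  δ_naturality (n : ℕ) {S S' : ShortComplex C} (hS : S.ShortExact) (hS' : S'.ShortExact)
    (a : S ⟶ S') : δ n S hS ≫ (obj (n + 1)).map a.τ₁ = (obj n).map a.τ₃ ≫ δ n S' hS'

namespace ConnectedSequence

variable {C C' D D' : Type*} [Category C] [Abelian C] [Category C'] [Abelian C']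
  [Category D] [Abelian D] [Category D'] [Abelian D']

/-- Morphisms of connected sequences. -/
@[ext]
structure Hom (F G : ConnectedSequence C D) where
  app (n : ℕ) : F.obj n ⟶ G.obj n
  comm (n : ℕ) (S : ShortComplex C) (hS : S.ShortExact) :
    F.δ n S hS ≫ (app (n + 1)).app S.X₁ = (app n).app S.X₃ ≫ G.δ n S hS

/-- A connected sequence `F` is universal if every natural transformation `F⁰ ⟶ G⁰` to the
degree zero part of a connected sequence `G` extends uniquely to a morphism `F ⟶ G`. -/
def IsUniversal (F : ConnectedSequence C D) : Prop :=
  ∀ (G : ConnectedSequence C D) (a : F.obj 0 ⟶ G.obj 0), ∃! b : Hom F G, b.app 0 = a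

/-- Precomposition of a connected sequence with an exact functor. -/
def precomp (L : C' ⥤ C) [L.Additive] [PreservesFiniteLimits L] [PreservesFiniteColimits L]
    (F : ConnectedSequence C D) : ConnectedSequence C' D where
  obj n := L ⋙ F.obj n
  additive n := by
    have := F.additive n
    infer_instance
  δ n S hS := F.δ n (S.map L) (hS.map_of_exact L)
  map_g_δ n S hS := F.map_g_δ n (S.map L) (hS.map_of_exact L)
  δ_map_f n S hS := F.δ_map_f n (S.map L) (hS.map_of_exact L)
  δ_naturality n _ _ hS hS' a :=
    F.δ_naturality n (hS.map_of_exact L) (hS'.map_of_exact L) (L.mapShortComplex.map a)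

/-- Postcomposition of a connected sequence with an additive functor. -/
def postcomp (F : ConnectedSequence C D) (L : D ⥤ D') [L.Additive] : ConnectedSequence C D' where
  obj n := F.obj n ⋙ L
  additive n := by
    have := F.additive n
    infer_instance
  δ n S hS := L.map (F.δ n S hS)
  map_g_δ n S hS := by simp [← L.map_comp, F.map_g_δ]
  δ_map_f n S hS := by simp [← L.map_comp, F.δ_map_f]
  δ_naturality n _ _ hS hS' a := by
    rw [Functor.comp_map, Functor.comp_map, ← L.map_comp, F.δ_naturality n hS hS' a, L.map_comp]

end ConnectedSequence

/-- The right satellites `S⁰F = F, S¹F, S²F, …` of a functor `F`: a universal connected sequence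
with degree zero part `F`. They are unique up to a unique isomorphism if they exist. -/
structure RightSatellites {C D : Type*} [Category C] [Abelian C] [Category D] [Abelian D]
    (F : C ⥤ D) where
  seq : ConnectedSequence C D
  zeroIso : seq.obj 0 ≅ F
  isUniversal : seq.IsUniversal

/-! ### Convergence of first quadrant spectral sequences -/

/-- For a first quadrant cohomological spectral sequence, the differentials into and out of the
entry `(p, q)` vanish on all pages `r` with `p < r` and `q + 1 < r`, so that `E_∞^{p,q}` is the
entry `(p, q)` of the page `p + q + 2`. -/
def pageInfty (A : Type v) [Category.{w} A] [Abelian A] (p q : ℕ) :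
    E₂CohomologicalSpectralSequenceNat A ⥤ A :=
  SpectralSequence.pageFunctor A _ 2 ((p : ℤ) + q + 2) (by lia) ⋙ HomologicalComplex.eval _ _ (p, q)

/-- Natural convergence `E₂^{p,q} ⇒ H^{p+q}` of a family of first quadrant spectral sequences `E`
depending functorially on `j : J`: a natural decreasing filtration
`H n = F⁰ ⊇ F¹ ⊇ ⋯ ⊇ Fⁿ ⊇ Fⁿ⁺¹ = 0` of `H n` together with natural isomorphisms
`Fᵖ / Fᵖ⁺¹ ≅ E_∞^{p,q}` for `p + q = n`, the latter given as short exact sequences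
`0 ⟶ Fᵖ⁺¹ ⟶ Fᵖ ⟶ E_∞^{p,q} ⟶ 0`. -/
structure Convergence {J : Type*} [Category J] {A : Type v} [Category.{w} A] [Abelian A]
    (E : J ⥤ E₂CohomologicalSpectralSequenceNat A) (H : ℕ → (J ⥤ A)) where
  fil (n p : ℕ) : J ⥤ A
  ι (n p : ℕ) : fil n p ⟶ H n
  mono_ι (n p : ℕ) (j : J) : Mono ((ι n p).app j)
  incl (n p : ℕ) : fil n (p + 1) ⟶ fil n p
  incl_ι (n p : ℕ) : incl n p ≫ ι n p = ι n (p + 1)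
  isIso_ι_zero (n : ℕ) (j : J) : IsIso ((ι n 0).app j)
  isZero_fil (n : ℕ) (j : J) : IsZero ((fil n (n + 1)).obj j)
  proj (p q : ℕ) : fil (p + q) p ⟶ E ⋙ pageInfty A p q
  incl_proj (p q : ℕ) (j : J) : (incl (p + q) p).app j ≫ (proj p q).app j = 0
  shortExact (p q : ℕ) (j : J) :
    (ShortComplex.mk ((incl (p + q) p).app j) ((proj p q).app j) (incl_proj p q j)).ShortExact

end Homological

namespace GabrielZisman

open Homological

/-! ### The simplex category of a simplicial set -/

/-- The simplex category `Δ/X`: objects are the simplices of `X`, morphisms `x ⟶ x'` are the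
morphisms `θ` of `Δ` with `x = X(θ)(x')`. -/
abbrev Simp (X : SSet.{u}) : Type u := X.Elementsᵒᵖ

/-- The functor `Δ/f : Δ/X ⥤ Δ/Y`, `x ↦ f x`. -/
abbrev simpMap {X Y : SSet.{u}} (f : X ⟶ Y) : Simp X ⥤ Simp Y :=
  (CategoryOfElements.map f).op

/-- The simplex `x ∈ X_n` as an object of `Δ/X`. -/
abbrev Simp.mk (X : SSet.{u}) {n : SimplexCategory} (x : X.obj (op n)) : Simp X :=
  op (X.elementsMk (op n) x)

/-- The morphism `X(θ)(x) ⟶ x` of `Δ/X` given by a morphism `θ` of `Δ`. -/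
abbrev Simp.homMk (X : SSet.{u}) {m n : SimplexCategory} (θ : m ⟶ n) (x : X.obj (op n)) :
    Simp.mk X (X.map θ.op x) ⟶ Simp.mk X x :=
  Quiver.Hom.op (CategoryOfElements.homMk (X.elementsMk (op n) x)
    (X.elementsMk (op m) (X.map θ.op x)) θ.op rfl)

variable (A : Type v) [Category.{w} A]

/-! ### Natural systems and their cohomology -/

/-- A Gabriel-Zisman natural system: a simplicial set `X` and a functor `T : Δ/X ⥤ A`. -/
structure NatSys where
  X : SSet.{u}
  T : Simp X ⥤ A

variable {A}

namespace NatSys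

/-- A morphism `(X, T) ⟶ (X', T')` is a simplicial map `φ : X' ⟶ X` together with a natural
transformation `T ∘ Δ/φ ⟶ T'`. -/
@[ext]
structure Hom (S S' : NatSys.{u} A) where
  φ : S'.X ⟶ S.X
  τ : simpMap φ ⋙ S.T ⟶ S'.T

instance : Category (NatSys.{u} A) where
  Hom := Hom
  id S := { φ := 𝟙 _, τ := 𝟙 S.T }
  comp {S S' S''} a b :=
    { φ := b.φ ≫ a.φ
      τ := (Functor.whiskerLeft (simpMap b.φ) a.τ :
        simpMap b.φ ⋙ simpMap a.φ ⋙ S.T ⟶ simpMap b.φ ⋙ S'.T) ≫ b.τ }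
  id_comp a := by
    refine Hom.ext (Category.comp_id a.φ) (heq_of_eq ?_)
    ext x
    exact Category.id_comp _
  comp_id a := by
    refine Hom.ext (Category.id_comp a.φ) (heq_of_eq ?_)
    ext x
    exact Category.comp_id _
  assoc a b c := by
    refine Hom.ext (Category.assoc c.φ b.φ a.φ).symm (heq_of_eq ?_)
    ext x
    exact Category.assoc _ _ _

lemma π_map_congr [HasProducts.{u} A] (S : NatSys.{u} A) {m : SimplexCategory}
    {x y : S.X.obj (op m)} (h : x = y) {z : Simp S.X} (a : Simp.mk S.X x ⟶ z)
    (b : Simp.mk S.X y ⟶ z) (hab : a.unop.val = b.unop.val) :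
    Pi.π (fun σ : S.X.obj (op m) ↦ S.T.obj (Simp.mk S.X σ)) x ≫ S.T.map a =
      Pi.π (fun σ : S.X.obj (op m) ↦ S.T.obj (Simp.mk S.X σ)) y ≫ S.T.map b := by
  subst h
  have : a = b := Quiver.Hom.unop_inj (Subtype.ext hab)
  rw [this]

/-- The cosimplicial object `[n] ↦ ∏ (σ : X_n), T σ`. A morphism `θ : [m] ⟶ [n]` induces the
morphism whose component at `σ ∈ X_n` is the projection to the factor `T (X(θ)(σ))` followed by
`T` of the morphism `X(θ)(σ) ⟶ σ` of `Δ/X`. -/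
def cosimplicial [HasProducts.{u} A] (S : NatSys.{u} A) : CosimplicialObject A where
  obj n := ∏ᶜ fun σ : S.X.obj (op n) ↦ S.T.obj (Simp.mk S.X σ)
  map {m n} θ := Pi.lift fun σ ↦
    Pi.π (fun σ : S.X.obj (op m) ↦ S.T.obj (Simp.mk S.X σ)) (S.X.map θ.op σ) ≫
      S.T.map (Simp.homMk S.X θ σ)
  map_id n := by
    refine Pi.hom_ext _ _ fun σ ↦ ?_
    rw [Pi.lift_π, Category.id_comp]
    refine (π_map_congr S (x := S.X.map (𝟙 n).op σ) (y := σ) (by simp)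
      (Simp.homMk S.X (𝟙 n) σ) (𝟙 (Simp.mk S.X σ)) rfl).trans ?_
    rw [S.T.map_id]
    exact Category.comp_id _
  map_comp {l m n} a b := by
    refine Pi.hom_ext _ _ fun σ ↦ ?_
    rw [Pi.lift_π, Category.assoc, Pi.lift_π, Pi.lift_π_assoc, Category.assoc, ← S.T.map_comp]
    exact π_map_congr S (by simp) _ _ rfl

/-- The component `T (φ σ) ⟶ T' σ` at a simplex `σ` of a morphism `(X, T) ⟶ (X', T')`. -/
def Hom.at {S S' : NatSys.{u} A} (a : Hom S S') {n : SimplexCategory} (σ : S'.X.obj (op n)) :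
    S.T.obj (Simp.mk S.X (a.φ.app (op n) σ)) ⟶ S'.T.obj (Simp.mk S'.X σ) :=
  a.τ.app (Simp.mk S'.X σ)

/-- The morphism `∏ (σ : X_n), T σ ⟶ ∏ (σ : X'_n), T' σ`, `(a_σ)_σ ↦ (τ_σ (a_{φ σ}))_σ`. -/
def mapAt [HasProducts.{u} A] {S S' : NatSys.{u} A} (a : S ⟶ S') (n : SimplexCategory) :
    (∏ᶜ fun σ : S.X.obj (op n) ↦ S.T.obj (Simp.mk S.X σ)) ⟶
      ∏ᶜ fun σ : S'.X.obj (op n) ↦ S'.T.obj (Simp.mk S'.X σ) :=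
  Pi.lift fun σ : S'.X.obj (op n) ↦
    Pi.π (fun σ : S.X.obj (op n) ↦ S.T.obj (Simp.mk S.X σ)) (a.φ.app (op n) σ) ≫ Hom.at a σ

/-- The functoriality of the cosimplicial object. -/
def cosimplicialFunctor [HasProducts.{u} A] : NatSys.{u} A ⥤ CosimplicialObject A where
  obj S := S.cosimplicial
  map {S S'} a :=
    { app n := mapAt a n
      naturality m n θ := by
        refine Pi.hom_ext _ _ fun σ ↦ ?_
        have h : Hom.at a (S'.X.map θ.op σ) ≫ S'.T.map (Simp.homMk S'.X θ σ) =
            S.T.map ((simpMap a.φ).map (Simp.homMk S'.X θ σ)) ≫ Hom.at a σ :=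
          (a.τ.naturality (Simp.homMk S'.X θ σ)).symm
        simp only [mapAt, cosimplicial, Category.assoc, Pi.lift_π, Pi.lift_π_assoc, h]
        refine (Category.assoc _ _ _).symm.trans (Eq.trans ?_ (Category.assoc _ _ _))
        exact congrArg (· ≫ Hom.at a σ) (π_map_congr S (NatTrans.naturality_apply a.φ θ.op σ).symm
          (Simp.homMk S.X θ (a.φ.app (op n) σ)) ((simpMap a.φ).map (Simp.homMk S'.X θ σ)) rfl) }
  map_id S := by
    ext n : 2
    refine Pi.hom_ext _ _ fun σ ↦ ?_
    exact (Pi.lift_π _ _).trans ((Category.comp_id _).trans (Category.id_comp _).symm)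
  map_comp {S S' S''} a b := by
    ext n : 2
    change mapAt (a ≫ b) n = mapAt a n ≫ mapAt b n
    refine Pi.hom_ext _ _ fun σ ↦ ?_
    have h : Hom.at (a ≫ b) σ = Hom.at a (b.φ.app (op n) σ) ≫ Hom.at b σ := rfl
    simp only [mapAt, Category.assoc, Pi.lift_π, Pi.lift_π_assoc, h]
    rfl

/-- The Gabriel-Zisman cochain complex `C_GZ^*(X, T)`, with `C_GZ^n(X, T) = ∏ (σ : X_n), T σ` and
differential the alternating sum of the coface maps, as a functor in `(X, T)`. -/
def cochainComplex [Abelian A] [HasProducts.{u} A] : NatSys.{u} A ⥤ CochainComplex A ℕ :=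
  cosimplicialFunctor ⋙ AlgebraicTopology.alternatingCofaceMapComplex A

/-- The Gabriel-Zisman cohomology `H_GZ^n(X, T)`, as a functor in `(X, T)`. -/
def cohomology [Abelian A] [HasProducts.{u} A] (n : ℕ) : NatSys.{u} A ⥤ A :=
  cochainComplex ⋙ HomologicalComplex.homologyFunctor A _ n

end NatSys

/-! ### Pullback and pushforward of natural systems -/

variable (A)

/-- Restriction `(Δ/f)^*` of natural systems along `f : X ⟶ Y`. -/
abbrev restrict {X Y : SSet.{u}} (f : X ⟶ Y) : (Simp Y ⥤ A) ⥤ (Simp X ⥤ A) :=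
  (Functor.whiskeringLeft (Simp X) (Simp Y) A).obj (simpMap f)

variable [Abelian A] [HasLimitsOfSize.{u, u} A]

instance {X Y : SSet.{u}} (f : X ⟶ Y) (T : Simp X ⥤ A) :
    (simpMap f).HasRightKanExtension T := by
  have : HasLimitsOfSize.{0, u} A := hasLimitsOfSizeShrink.{0, u, u, u} A
  infer_instance

/-- The right Kan extension `(Δ/f)_* = Ran_{Δ/f}` of natural systems along `f : X ⟶ Y`. -/
abbrev pushforward {X Y : SSet.{u}} (f : X ⟶ Y) : (Simp X ⥤ A) ⥤ (Simp Y ⥤ A) :=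
  (simpMap f).ran

/-- The base change transformation `(Δ/ψ)^* (Δ/f)_* ⟶ (Δ/f')_* (Δ/φ)^*` of a commutative square
`φ ≫ f = f' ≫ ψ`: the mate of the identification `(Δ/f')^* (Δ/ψ)^* = (Δ/φ)^* (Δ/f)^*`. -/
def baseChange {X Y X' Y' : SSet.{u}} {f : X ⟶ Y} {f' : X' ⟶ Y'} {φ : X' ⟶ X} {ψ : Y' ⟶ Y}
    (h : φ ≫ f = f' ≫ ψ) :
    pushforward A f ⋙ restrict A ψ ⟶ restrict A φ ⋙ pushforward A f' :=
  (mateEquiv ((simpMap f).ranAdjunction A) ((simpMap f').ranAdjunction A)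
    (TwoSquare.mk _ _ _ _ (eqToHom (show restrict A ψ ⋙ restrict A f' =
      restrict A f ⋙ restrict A φ from congrArg (fun g ↦ restrict A g) h.symm)))).natTrans

variable {A}

/-- For a commutative square `φ ≫ f = f' ≫ ψ`, the extension of the base change transformation to
a morphism of connected sequences `(Δ/ψ)^* R^q(Δ/f)_* ⟶ R^q(Δ/f')_* (Δ/φ)^*`. -/
def IsSatelliteBaseChange {X Y X' Y' : SSet.{u}} {f : X ⟶ Y} {f' : X' ⟶ Y'} {φ : X' ⟶ X} {ψ : Y' ⟶ Y}
    (h : φ ≫ f = f' ≫ ψ) (R : RightSatellites (pushforward A f))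
    (R' : RightSatellites (pushforward A f'))
    (β : ConnectedSequence.Hom (R.seq.postcomp (restrict A ψ)) (R'.seq.precomp (restrict A φ))) :
    Prop :=
  β.app 0 ≫ Functor.whiskerLeft (restrict A φ) R'.zeroIso.hom =
    Functor.whiskerRight R.zeroIso.hom (restrict A ψ) ≫ baseChange A h

/-! ### The category of maps with a natural system on the source -/

variable (A) in
/-- A simplicial map `f : X ⟶ Y` with a natural system `T : Δ/X ⥤ A` on its source. -/
structure MapSys extends NatSys.{u} A where
  Y : SSet.{u}
  f : X ⟶ Y

namespace MapSys

/-- A morphism `(f, T) ⟶ (f', T')` consists of a commutative square `φ ≫ f = f' ≫ ψ` of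
simplicial maps `φ : X' ⟶ X`, `ψ : Y' ⟶ Y`, and a natural transformation `T ∘ Δ/φ ⟶ T'`. -/
@[ext]
structure Hom (S S' : MapSys.{u} A) where
  base : S.toNatSys ⟶ S'.toNatSys
  ψ : S'.Y ⟶ S.Y
  w : base.φ ≫ S.f = S'.f ≫ ψ

instance : Category (MapSys.{u} A) where
  Hom := Hom
  id S := { base := 𝟙 _, ψ := 𝟙 _, w := rfl }
  comp {S S' S''} a b :=
    { base := a.base ≫ b.base
      ψ := b.ψ ≫ a.ψ
      w := by
        change (b.base.φ ≫ a.base.φ) ≫ S.f = S''.f ≫ b.ψ ≫ a.ψ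
        rw [Category.assoc, a.w, ← Category.assoc, b.w, Category.assoc] }
  id_comp a := Hom.ext (Category.id_comp a.base) (Category.comp_id a.ψ)
  comp_id a := Hom.ext (Category.comp_id a.base) (Category.id_comp a.ψ)
  assoc a b c := Hom.ext (Category.assoc a.base b.base c.base) (Category.assoc c.ψ b.ψ a.ψ).symm

/-- The functor `(f : X ⟶ Y, T) ↦ (X, T)`. -/
def source : MapSys.{u} A ⥤ NatSys.{u} A where
  obj S := S.toNatSys
  map a := a.base

/-- The natural system `(Y, R^q(Δ/f)_* T)`. -/
def direct (S : MapSys.{u} A) (R : RightSatellites (pushforward A S.f)) (q : ℕ) : NatSys.{u} A where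
  X := S.Y
  T := (R.seq.obj q).obj S.T

/-- The morphism `(Y, R^q(Δ/f)_* T) ⟶ (Y', R^q(Δ/f')_* T')` induced by a morphism
`(f, T) ⟶ (f', T')`: the composition
`(Δ/ψ)^* R^q(Δ/f)_* T ⟶ R^q(Δ/f')_* (Δ/φ)^* T ⟶ R^q(Δ/f')_* T'`. -/
def directMap {S S' : MapSys.{u} A} (m : S ⟶ S') (R : RightSatellites (pushforward A S.f))
    (R' : RightSatellites (pushforward A S'.f))
    (β : ConnectedSequence.Hom (R.seq.postcomp (restrict A m.ψ))
      (R'.seq.precomp (restrict A m.base.φ))) (q : ℕ) :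
    S.direct R q ⟶ S'.direct R' q :=
  NatSys.Hom.mk (S := S.direct R q) (S' := S'.direct R' q) m.ψ
    ((β.app q).app S.T ≫ (R'.seq.obj q).map m.base.τ)

end MapSys

end GabrielZisman

end

open Homological GabrielZisman

/-!
# The Leray spectral sequence of a simplicial map

For a map `f : X ⟶ Y` of simplicial sets the functor `Δ/f : Δ/X ⥤ Δ/Y` is a discrete fibration:
an arrow `y ⟶ f x` lifts uniquely to an arrow with target `x`. The right Kan extension `f_*` along
`Δ/f` is therefore the product over the fibres, `(f_* T)(y) = ∏ (x ∈ f⁻¹ y), T x`. If products are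
exact, then so is `f_*`; hence its satellites vanish in positive degrees, every spectral sequence
with `E₂^{p,q} ≅ H_GZ^p(Y, R^q f_* T)` lies in the row `q = 0`, and the edge morphism
`H_GZ^p(Y, f_* T) ⟶ H_GZ^p(X, T)` is an isomorphism, already on cochains.
-/

noncomputable section

namespace Homological

/-! ### Satellites of exact functors -/

section Satellites

variable {C D : Type*} [Category C] [Category D] [Abelian D]

open ZeroObject

/-! The comma category `y ↓ Δ/f` splits into pieces, one for each simplex in the fibre over `y`, and
that simplex is initial in its piece; this turns the limit computing `(f_* T)(y)` into a product
(`isLimitFibreFan`). Exactness of products enters only through preservation of epimorphisms, and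
that already kills the satellites. For a short exact sequence `0 → A → B → C → 0` the connecting
morphism out of `F⁰ C` vanishes on the image of the epimorphism `F⁰ B → F⁰ C`, hence is zero; by
universality the identity then equals the endomorphism that is zero in positive degrees
(`RightSatellites.isZero_succ`).

The row `q = 0` is built from `H_GZ^p(X, T)` itself rather than from `H_GZ^p(Y, f_* T)`.
Functoriality and convergence are then formal and do not depend on the chosen satellites; the
content lies in the natural identification of `E₂`. It is induced by the morphism `(Y, R⁰f_* T) ⟶
(X, T)` given by `f` and the counit. This is invertible on cochains because `X_n` is the disjoint
union of the fibres over `Y_n`, and natural because base change, being a mate, is compatible with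
counits (`MapSys.directMap_comp_ofDirect`). -/

/-- The functors `F, 0, 0, …`. -/
def concentrated (F : C ⥤ D) (n : ℕ) : C ⥤ D :=
  Nat.casesOn n F fun _ ↦ 0

lemma isZero_concentrated_succ (F : C ⥤ D) (n : ℕ) : IsZero (concentrated F (n + 1)) :=
  isZero_zero _

variable [Abelian C]

/-- The connected sequence `F, 0, 0, …` with zero connecting morphisms. -/
def ConnectedSequence.ofFunctor (F : C ⥤ D) [F.Additive] : ConnectedSequence C D where
  obj := concentrated F
  additive n := by
    cases n with
    | zero => exact inferInstanceAs F.Additive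
    | succ n => exact ⟨fun {X Y f g} ↦ ((isZero_concentrated_succ F n).obj X).eq_of_src _ _⟩
  δ _ _ _ := 0
  map_g_δ _ _ _ := comp_zero
  δ_map_f _ _ _ := zero_comp
  δ_naturality _ _ _ _ _ _ := by rw [zero_comp, comp_zero]

/-- If `F⁰` preserves epimorphisms, the first connecting morphisms vanish, since they vanish
on the image of an epimorphism. -/
lemma ConnectedSequence.app_comp_δ_zero {F : C ⥤ D} [F.PreservesEpimorphisms]
    (G : ConnectedSequence C D) (a : F ⟶ G.obj 0) (S : ShortComplex C) (hS : S.ShortExact) :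
    a.app S.X₃ ≫ G.δ 0 S hS = 0 := by
  have := hS.epi_g
  rw [← cancel_epi (F.map S.g), ← Category.assoc, a.naturality, Category.assoc, G.map_g_δ,
    comp_zero, comp_zero]

/-- A functor which preserves epimorphisms has right satellites, and these vanish in positive
degrees. -/
def RightSatellites.ofPreservesEpimorphisms (F : C ⥤ D) [F.Additive] [F.PreservesEpimorphisms] :
    RightSatellites F where
  seq := ConnectedSequence.ofFunctor F
  zeroIso := Iso.refl F
  isUniversal G a := by
    refine ⟨⟨fun n ↦ Nat.casesOn n a fun _ ↦ 0, fun n S hS ↦ ?_⟩, rfl, fun b hb ↦ ?_⟩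
    · cases n with
      | zero => exact (zero_comp).trans (G.app_comp_δ_zero (F := F) a S hS).symm
      | succ n => exact ((isZero_concentrated_succ F n).obj _).eq_of_src _ _
    · ext n : 2
      cases n with
      | zero => exact hb
      | succ n => exact (isZero_concentrated_succ F n).eq_of_src _ _

variable {F : C ⥤ D} [F.PreservesEpimorphisms]

lemma RightSatellites.δ_zero (R : RightSatellites F) (S : ShortComplex C) (hS : S.ShortExact) :
    R.seq.δ 0 S hS = 0 := by
  have h := R.seq.app_comp_δ_zero R.zeroIso.inv S hS
  rwa [Preadditive.IsIso.comp_left_eq_zero] at h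

/-- The right satellites of a functor which preserves epimorphisms vanish in positive degrees. -/
lemma RightSatellites.isZero_succ (R : RightSatellites F) (n : ℕ) :
    IsZero (R.seq.obj (n + 1)) := by
  -- Both endomorphisms are the identity in degree zero. The second one is compatible with the
  -- connecting morphisms because the first of these is zero.
  have h : (⟨fun n ↦ 𝟙 _, by simp⟩ : ConnectedSequence.Hom R.seq R.seq) =
      ⟨fun n ↦ Nat.casesOn n (𝟙 _) fun _ ↦ 0, fun n S hS ↦ by cases n <;> simp [R.δ_zero]⟩ :=
    (R.isUniversal R.seq (𝟙 _)).unique rfl rfl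
  rw [IsZero.iff_id_eq_zero]
  exact congrFun (congrArg ConnectedSequence.Hom.app h) (n + 1)

/-- Between connected sequences which vanish in positive degrees, every natural transformation of
the degree zero parts extends uniquely to a morphism. -/
lemma ConnectedSequence.existsUnique_hom (F G : ConnectedSequence C D)
    (hF : ∀ n, IsZero (F.obj (n + 1))) (hG : ∀ n, IsZero (G.obj (n + 1)))
    (a : F.obj 0 ⟶ G.obj 0) : ∃! b : Hom F G, b.app 0 = a := by
  refine ⟨⟨fun n ↦ Nat.casesOn n a fun _ ↦ 0, fun n S hS ↦ ((hG n).obj _).eq_of_tgt _ _⟩, rfl,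
    fun b hb ↦ ?_⟩
  ext n : 2
  cases n with
  | zero => exact hb
  | succ n => exact (hF n).eq_of_src _ _

end Satellites

/-! ### Spectral sequences concentrated in one row -/

section Row

open ZeroObject

variable {J : Type*} [Category J] {A : Type v} [Category.{w} A] [Abelian A] (H : ℕ → (J ⥤ A))

/-- The bigraded functor with `H p` in position `(p, 0)` and zero elsewhere. -/
def rowEntry (pq : ℕ × ℕ) : J ⥤ A :=
  Nat.casesOn pq.2 (H pq.1) fun _ ↦ 0

lemma isZero_rowEntry (p q : ℕ) : IsZero (rowEntry H (p, q + 1)) := isZero_zero _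

/-- The complex with zero differentials on a graded object. -/
def zeroDifferential {κ : Type*} (c : ComplexShape κ) : (κ → A) ⥤ HomologicalComplex A c where
  obj X := { X := X, d _ _ := 0 }
  map φ := { f := φ }

/-- The homology of a complex with zero differentials. -/
def zeroDifferentialHomologyIso {κ : Type*} (c : ComplexShape κ) (X : κ → A) (k : κ) :
    ((zeroDifferential c).obj X).homology k ≅ X k :=
  (ShortComplex.LeftHomologyData.ofZeros (((zeroDifferential c).obj X).sc k) rfl rfl).homologyIso

/-- With zero differentials, cycles and homology are the whole term, so the map induced on homology
is the given map. -/
lemma zeroDifferentialHomologyIso_naturality {κ : Type*} (c : ComplexShape κ) {X Y : κ → A}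
    (φ : X ⟶ Y) (k : κ) :
    HomologicalComplex.homologyMap ((zeroDifferential c).map φ) k ≫
        (zeroDifferentialHomologyIso c Y k).hom =
      (zeroDifferentialHomologyIso c X k).hom ≫ φ k :=
  (ShortComplex.LeftHomologyMapData.ofZeros ((HomologicalComplex.shortComplexFunctor A c k).map
    ((zeroDifferential c).map φ)) rfl rfl rfl rfl).homologyMap_comm

/-- The family of spectral sequences with `H p` in position `(p, 0)` of every page, zero elsewhere,
and zero differentials. -/
def rowSpectralSequence : J ⥤ E₂CohomologicalSpectralSequenceNat A where
  obj j :=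
    { page r _ := (zeroDifferential _).obj fun pq ↦ (rowEntry H pq).obj j
      iso r r' pq _ _ := zeroDifferentialHomologyIso _ _ pq }
  map f :=
    { hom r _ := (zeroDifferential _).map fun pq ↦ (rowEntry H pq).map f
      comm r r' pq _ _ := zeroDifferentialHomologyIso_naturality _ _ pq }
  map_id j := by
    ext r hr pq
    exact (rowEntry H pq).map_id j
  map_comp f g := by
    ext r hr pq
    exact (rowEntry H pq).map_comp f g

/-- The filtration `H n = F⁰ = ⋯ = Fⁿ ⊇ Fⁿ⁺¹ = 0`. -/
def rowFiltration (n p : ℕ) : J ⥤ A :=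
  if p ≤ n then H n else 0

lemma rowFiltration_of_le {n p : ℕ} (h : p ≤ n) : rowFiltration H n p = H n := if_pos h

lemma isZero_rowFiltration {n p : ℕ} (h : n < p) : IsZero (rowFiltration H n p) := by
  rw [rowFiltration, if_neg (by lia)]
  exact isZero_zero _

/-- The inclusion of `Fᵖ` in `H n`. -/
def rowFiltrationι (n p : ℕ) : rowFiltration H n p ⟶ H n :=
  if h : p ≤ n then eqToHom (rowFiltration_of_le H h) else 0

lemma isIso_rowFiltrationι {n p : ℕ} (h : p ≤ n) : IsIso (rowFiltrationι H n p) := by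
  rw [rowFiltrationι, dif_pos h]
  infer_instance

/-- The inclusion of `Fᵖ⁺¹` in `Fᵖ`. -/
def rowFiltrationIncl (n p : ℕ) : rowFiltration H n (p + 1) ⟶ rowFiltration H n p :=
  if h : p + 1 ≤ n then
    eqToHom ((rowFiltration_of_le H h).trans (rowFiltration_of_le H (by lia)).symm)
  else 0

lemma isIso_rowFiltrationIncl {n p : ℕ} (h : p + 1 ≤ n) : IsIso (rowFiltrationIncl H n p) := by
  rw [rowFiltrationIncl, dif_pos h]
  infer_instance

/-- The projection of `Fᵖ` to the entry `(p, q)`: for `q = 0` it is an isomorphism. -/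
def rowFiltrationProj (p q : ℕ) :
    rowFiltration H (p + q) p ⟶ rowSpectralSequence H ⋙ pageInfty A p q :=
  Nat.casesOn q
    (eqToHom (rowFiltration_of_le H (le_refl p)) ≫
      -- The pages do not depend on `r`, so the entry `(p, 0)` of `E_∞` is `H p` by definition.
      { app j := 𝟙 ((H p).obj j)
        naturality _ _ _ := (Category.comp_id _).trans (Category.id_comp _).symm })
    fun _ ↦ 0

lemma isIso_rowFiltrationProj (p : ℕ) (j : J) : IsIso ((rowFiltrationProj H p 0).app j) := by
  have : IsIso ((eqToHom (rowFiltration_of_le H (le_refl p))).app j) := inferInstance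
  exact (inferInstance :
    IsIso ((eqToHom (rowFiltration_of_le H (le_refl p))).app j ≫ 𝟙 ((H p).obj j)))

/-- A spectral sequence concentrated in the row `q = 0` converges to that row. -/
def rowConvergence : Convergence (rowSpectralSequence H) H where
  fil := rowFiltration H
  ι := rowFiltrationι H
  mono_ι n p j := by
    by_cases h : p ≤ n
    · have := isIso_rowFiltrationι H h
      infer_instance
    · exact ((isZero_rowFiltration H (by lia)).obj j).mono _
  incl := rowFiltrationIncl H
  incl_ι n p := by
    by_cases h : p + 1 ≤ n
    · rw [rowFiltrationIncl, rowFiltrationι, rowFiltrationι, dif_pos h, dif_pos h,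
        dif_pos (by lia), eqToHom_trans]
    · exact (isZero_rowFiltration H (by lia)).eq_of_src _ _
  isIso_ι_zero n j := by
    have := isIso_rowFiltrationι H (Nat.zero_le n)
    infer_instance
  isZero_fil n j := (isZero_rowFiltration H (Nat.lt_succ_self n)).obj j
  proj := rowFiltrationProj H
  incl_proj p q j := by
    cases q with
    -- In total degree `p` the step `Fᵖ⁺¹` is already zero; for `q > 0` it is the entry of `E_∞`
    -- that vanishes.
    | zero => exact ((isZero_rowFiltration H (Nat.lt_succ_self p)).obj j).eq_of_src _ _
    | succ q => exact ((isZero_rowEntry H p q).obj j).eq_of_tgt _ _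
  shortExact p q j := by
    cases q with
    | zero =>
      have := isIso_rowFiltrationProj H p j
      have h : IsZero ((rowFiltration H p (p + 1)).obj j) :=
        (isZero_rowFiltration H (Nat.lt_succ_self p)).obj j
      have : Mono ((rowFiltrationIncl H (p + 0) p).app j) := h.mono _
      exact
        { exact := (ShortComplex.exact_iff_mono _ (h.eq_of_src _ _)).2
            (inferInstanceAs (Mono ((rowFiltrationProj H p 0).app j)))
          mono_f := this
          epi_g := inferInstanceAs (Epi ((rowFiltrationProj H p 0).app j)) }
    | succ q =>
      have := isIso_rowFiltrationIncl H (n := p + (q + 1)) (p := p) (by lia)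
      have h : IsZero ((rowSpectralSequence H ⋙ pageInfty A p (q + 1)).obj j) :=
        (isZero_rowEntry H p q).obj j
      exact
        { exact := (ShortComplex.exact_iff_epi _ (h.eq_of_tgt _ _)).2
            (inferInstanceAs (Epi ((rowFiltrationIncl H (p + (q + 1)) p).app j)))
          mono_f := inferInstanceAs (Mono ((rowFiltrationIncl H (p + (q + 1)) p).app j))
          epi_g := h.epi _ }

end Row

end Homological

end

noncomputable section

namespace GabrielZisman

open Homological

/-! ### Pushforward as a fibrewise product -/

section Fibre

variable {X Y : SSet.{u}} (f : X ⟶ Y)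

/-- The simplices of `X` over the simplex `y` of `Y`. -/
def Fibre (y : Simp Y) : Type u := { x : X.obj y.unop.1 // f.app y.unop.1 x = y.unop.2 }

variable {f}

/-- A simplex in the fibre as an object of `Δ/X`. -/
def Fibre.simp {y : Simp Y} (s : Fibre f y) : Simp X := op ⟨y.unop.1, s.1⟩

/-- The identification of `y` with the image of a simplex in the fibre over `y`. -/
def Fibre.hom {y : Simp Y} (s : Fibre f y) : y ⟶ (simpMap f).obj s.simp :=
  Quiver.Hom.op ⟨𝟙 _, (ConcreteCategory.congr_hom (Y.map_id y.unop.1) _).trans s.2⟩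

/-- Since `Δ/f` is a discrete fibration, an arrow `y ⟶ f x` determines a simplex `X(θ)(x)` in the
fibre over `y`. -/
def Fibre.ofHom {y : Simp Y} {x : Simp X} (a : y ⟶ (simpMap f).obj x) : Fibre f y :=
  ⟨X.map a.unop.1 x.unop.2, (NatTrans.naturality_apply f a.unop.1 x.unop.2).trans a.unop.2⟩

/-- The canonical morphism `X(θ)(x) ⟶ x`. -/
def Fibre.ofHomTo {y : Simp Y} {x : Simp X} (a : y ⟶ (simpMap f).obj x) :
    (Fibre.ofHom a).simp ⟶ x :=
  Quiver.Hom.op ⟨a.unop.1, rfl⟩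

/-- Existence of the lift in the discrete fibration: every object of `y ↓ Δ/f` receives an arrow
from an object given by the fibre. -/
lemma Fibre.hom_ofHomTo {y : Simp Y} {x : Simp X} (a : y ⟶ (simpMap f).obj x) :
    (Fibre.ofHom a).hom ≫ (simpMap f).map (Fibre.ofHomTo a) = a :=
  Quiver.Hom.unop_inj (Subtype.ext (Category.comp_id _))

lemma Fibre.ofHom_hom {y : Simp Y} (s : Fibre f y) : Fibre.ofHom s.hom = s :=
  Subtype.ext (show X.map (𝟙 y.unop.1) s.1 = s.1 by simp)

/-- By functoriality of `X`, the simplex of the fibre attached to an object of `y ↓ Δ/f` is constant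
on connected components. -/
lemma Fibre.ofHom_eq_of_comp {y : Simp Y} {x x' : Simp X} (a : y ⟶ (simpMap f).obj x)
    (b : x ⟶ x') (a' : y ⟶ (simpMap f).obj x') (h : a ≫ (simpMap f).map b = a') :
    Fibre.ofHom a' = Fibre.ofHom a := by
  subst h
  refine Subtype.ext ?_
  refine (ConcreteCategory.congr_hom (X.map_comp b.unop.1 a.unop.1) x'.unop.2).trans ?_
  exact congrArg (X.map a.unop.1) b.unop.2

lemma simp_hom_ext {x y : Simp X} (a b : x ⟶ y) (h : a.unop.1 = b.unop.1) : a = b :=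
  Quiver.Hom.unop_inj (Subtype.ext h)

end Fibre

variable {A : Type v} [Category.{w} A]

section Pushforward

variable {X Y : SSet.{u}} (f : X ⟶ Y) (T : Simp X ⥤ A)

/-- Fibre simplices are often equal without being so by definition. Comparing only the underlying
arrows of `Δ` avoids transporting along such equalities. -/
lemma fan_comp_map {y : Simp Y} {W : A} (k : ∀ s : Fibre f y, W ⟶ T.obj s.simp)
    {s t : Fibre f y} (h : s = t) {z : Simp X} (a : s.simp ⟶ z) (b : t.simp ⟶ z)
    (hab : a.unop.1 = b.unop.1) : k s ≫ T.map a = k t ≫ T.map b := by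
  subst h
  rw [simp_hom_ext a b hab]

variable [HasLimitsOfSize.{u, u} A]

instance (T : Simp X ⥤ A) : (simpMap f).HasPointwiseRightKanExtension T := by
  have : HasLimitsOfSize.{0, u} A := hasLimitsOfSizeShrink.{0, u, u, u} A
  infer_instance

/-- The fan with point `(f_* T)(y)` over the values of `T` on the fibre over `y`. -/
def fibreFan (y : Simp Y) : Fan fun s : Fibre f y ↦ T.obj s.simp :=
  Fan.mk (((pushforward A f).obj T).obj y) fun s ↦
    ((pushforward A f).obj T).map s.hom ≫ ((simpMap f).ranCounit.app T).app s.simp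

/-- Naturality of the counit along the lifted arrow: the legs of the limit cone over `y ↓ Δ/f` are
determined by those at the fibre. -/
lemma map_comp_ranCounit {y : Simp Y} {x : Simp X} (a : y ⟶ (simpMap f).obj x) :
    ((pushforward A f).obj T).map a ≫ ((simpMap f).ranCounit.app T).app x =
      (fibreFan f T y).proj (Fibre.ofHom a) ≫ T.map (Fibre.ofHomTo a) := by
  have h := ((simpMap f).ranCounit.app T).naturality (Fibre.ofHomTo a)
  dsimp at h
  conv_lhs => rw [← Fibre.hom_ofHomTo a, Functor.map_comp, Category.assoc]
  erw [h]
  exact (Category.assoc _ _ _).symm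

/-- The value of `f_* T` at `y` is the product of the values of `T` on the fibre over `y`. -/
def isLimitFibreFan (y : Simp Y) : IsLimit (fibreFan f T y) := by
  let hy := (simpMap f).isPointwiseRightKanExtensionRanCounit T y
  -- A family over the fibre extends to a cone over all of `y ↓ Δ/f` through the arrows from the
  -- fibre simplices; the limit property is then applied to this cone.
  let c (W : A) (k : ∀ s : Fibre f y, W ⟶ T.obj s.simp) :
      Cone (StructuredArrow.proj y (simpMap f) ⋙ T) :=
    { pt := W
      π :=
        { app g := k (Fibre.ofHom g.hom) ≫ T.map (Fibre.ofHomTo g.hom)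
          naturality g g' b := by
            refine (Category.id_comp _).trans ?_
            refine Eq.trans ?_ (Category.assoc _ _ _).symm
            refine Eq.trans ?_ (congrArg (k (Fibre.ofHom g.hom) ≫ ·) (T.map_comp _ b.right))
            exact fan_comp_map f T k (Fibre.ofHom_eq_of_comp _ _ _ (StructuredArrow.w b)) _ _
              (congrArg (fun a ↦ a.unop.1) (StructuredArrow.w b)).symm } }
  refine Fan.IsLimit.mk _ (fun s ↦ hy.lift (c s.pt s.proj)) (fun s t ↦ ?_) (fun s m hm ↦ ?_)
  · refine (hy.fac (c s.pt s.proj) (StructuredArrow.mk t.hom)).trans ?_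
    refine (fan_comp_map f T s.proj (s := Fibre.ofHom t.hom) (t := t) t.ofHom_hom
      (Fibre.ofHomTo t.hom) (𝟙 t.simp) rfl).trans ?_
    rw [T.map_id]
    exact Category.comp_id _
  · refine hy.hom_ext fun g ↦ ?_
    refine Eq.trans ?_ (hy.fac (c s.pt s.proj) g).symm
    refine (congrArg (m ≫ ·) (map_comp_ranCounit f T g.hom)).trans ?_
    refine (Category.assoc _ _ _).symm.trans ?_
    exact congrArg (· ≫ T.map (Fibre.ofHomTo g.hom)) (hm (Fibre.ofHom g.hom))

variable [HasProducts.{u} A]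

/-- The isomorphism of `(f_* T)(y)` with the product of the values of `T` on the fibre over `y`. -/
def pushforwardObjIso (y : Simp Y) :
    ((pushforward A f).obj T).obj y ≅ ∏ᶜ fun s : Fibre f y ↦ T.obj s.simp :=
  (isLimitFibreFan f T y).conePointUniqueUpToIso (limit.isLimit _)

lemma pushforwardObjIso_hom_π (y : Simp Y) (s : Fibre f y) :
    (pushforwardObjIso f T y).hom ≫ Pi.π (fun s : Fibre f y ↦ T.obj s.simp) s =
      ((pushforward A f).obj T).map s.hom ≫ ((simpMap f).ranCounit.app T).app s.simp :=
  (isLimitFibreFan f T y).conePointUniqueUpToIso_hom_comp (limit.isLimit _) ⟨s⟩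

variable {T} in
lemma pushforwardObjIso_naturality {T' : Simp X ⥤ A} (τ : T ⟶ T') (y : Simp Y) :
    ((pushforward A f).map τ).app y ≫ (pushforwardObjIso f T' y).hom =
      (pushforwardObjIso f T y).hom ≫ Limits.Pi.map fun s : Fibre f y ↦ τ.app s.simp := by
  refine Pi.hom_ext _ _ fun s ↦ ?_
  have h : ((pushforward A f).map τ).app ((simpMap f).obj s.simp) ≫
      ((simpMap f).ranCounit.app T').app s.simp =
        ((simpMap f).ranCounit.app T).app s.simp ≫ τ.app s.simp :=
    NatTrans.congr_app ((simpMap f).ranCounit.naturality τ) s.simp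
  rw [Category.assoc, Category.assoc, Pi.map_π, ← Category.assoc (pushforwardObjIso f T y).hom,
    pushforwardObjIso_hom_π, pushforwardObjIso_hom_π, Category.assoc, ← h, NatTrans.naturality_assoc]

end Pushforward

/-! ### Exactness of the pushforward -/

section Exactness

variable [Abelian A] [HasLimitsOfSize.{u, u} A] [HasProducts.{u} A]

instance {X Y : SSet.{u}} (f : X ⟶ Y) : (pushforward A f).Additive :=
  ((simpMap f).ranAdjunction A).right_adjoint_additive

/-- Epimorphisms of natural systems are detected pointwise, and at `y` the map is, up to
isomorphism, a product of epimorphisms over the fibre. -/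
instance [AB4StarOfSize.{u} A] {X Y : SSet.{u}} (f : X ⟶ Y) :
    (pushforward A f).PreservesEpimorphisms where
  preserves {T T'} τ _ := by
    refine @NatTrans.epi_of_epi_app _ _ _ _ _ _ _ fun y ↦ ?_
    let α : Discrete.functor (fun s : Fibre f y ↦ T.obj s.simp) ⟶
        Discrete.functor fun s : Fibre f y ↦ T'.obj s.simp :=
      Discrete.natTrans fun s ↦ τ.app s.as.simp
    have (s : Discrete (Fibre f y)) : Epi (α.app s) := inferInstanceAs (Epi (τ.app s.as.simp))
    have : Epi α := NatTrans.epi_of_epi_app α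
    have : Epi (Limits.Pi.map fun s : Fibre f y ↦ τ.app s.simp) :=
      inferInstanceAs (Epi (lim.map α))
    rw [(Iso.eq_comp_inv _).2 (pushforwardObjIso_naturality f τ y)]
    infer_instance

end Exactness

/-! ### Cohomology of the pushforward -/

namespace NatSys

/-- The two transformations have different sources until the simplicial maps are identified; the
`eqToHom` correction replaces a heterogeneous equality. -/
lemma hom_ext {S S' : NatSys.{u} A} {a b : S ⟶ S'} (hφ : a.φ = b.φ)
    (hτ : ∀ x : Simp S'.X, a.τ.app x =
      S.T.map (eqToHom (by rw [hφ])) ≫ b.τ.app x) : a = b := by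
  obtain ⟨φ, τ⟩ := a
  obtain ⟨φ', τ'⟩ := b
  obtain rfl : φ = φ' := hφ
  congr
  ext x
  refine (hτ x).trans ?_
  exact (congrArg (· ≫ τ'.app x) (S.T.map_id _)).trans (Category.id_comp _)

/-- Isomorphic functors define isomorphic natural systems. -/
def isoMk (X : SSet.{u}) {T T' : Simp X ⥤ A} (e : T ≅ T') : NatSys.mk X T ≅ NatSys.mk X T' where
  hom := NatSys.Hom.mk (S := ⟨X, T⟩) (S' := ⟨X, T'⟩) (𝟙 X) e.hom
  inv := NatSys.Hom.mk (S := ⟨X, T'⟩) (S' := ⟨X, T⟩) (𝟙 X) e.inv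
  hom_inv_id := by
    refine Hom.ext (Category.id_comp _) (heq_of_eq ?_)
    ext x
    exact e.hom_inv_id_app x
  inv_hom_id := by
    refine Hom.ext (Category.id_comp _) (heq_of_eq ?_)
    ext x
    exact e.inv_hom_id_app x

lemma isZero_cohomology [Abelian A] [HasProducts.{u} A] (S : NatSys.{u} A) (hS : IsZero S.T) (n : ℕ) :
    IsZero ((cohomology n).obj S) := by
  refine (ShortComplex.exact_iff_isZero_homology _).1 (ShortComplex.exact_of_isZero_X₂ _ ?_)
  have h : IsZero (∏ᶜ fun σ : S.X.obj (op ⦋n⦌) ↦ S.T.obj (Simp.mk S.X σ)) :=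
    by
    rw [IsZero.iff_id_eq_zero]
    exact Pi.hom_ext _ _ fun σ ↦ (hS.obj _).eq_of_tgt _ _
  exact h

variable [HasLimitsOfSize.{u, u} A] [HasProducts.{u} A]

/-- The morphism `(Y, f_* T) ⟶ (X, T)` given by `f` and the counit `f^* f_* T ⟶ T`. -/
def ofPushforward {X Y : SSet.{u}} (f : X ⟶ Y) (T : Simp X ⥤ A) :
    NatSys.mk Y ((pushforward A f).obj T) ⟶ NatSys.mk X T :=
  NatSys.Hom.mk (S := ⟨Y, (pushforward A f).obj T⟩) (S' := ⟨X, T⟩) f ((simpMap f).ranCounit.app T)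

/-- A product over `X_n` can be regrouped along the fibres of `X_n → Y_n`. -/
instance {X Y : SSet.{u}} (f : X ⟶ Y) (T : Simp X ⥤ A) (n : SimplexCategory) :
    IsIso (mapAt (ofPushforward f T) n) := by
  -- The component at `y` of the inverse: project to the factors in the fibre, then reassemble `(f_*
  -- T)(y)`.
  let k (y : Y.obj (op n)) : (∏ᶜ fun x : X.obj (op n) ↦ T.obj (Simp.mk X x)) ⟶
      ((pushforward A f).obj T).obj (Simp.mk Y y) :=
    Pi.lift (fun s : Fibre f (Simp.mk Y y) ↦ Pi.π (fun x : X.obj (op n) ↦ T.obj (Simp.mk X x)) s.1) ≫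
      (pushforwardObjIso f T (Simp.mk Y y)).inv
  have hπ (x : X.obj (op n)) : mapAt (ofPushforward f T) n ≫
      Pi.π (fun x : X.obj (op n) ↦ T.obj (Simp.mk X x)) x =
        Pi.π (fun y : Y.obj (op n) ↦ ((pushforward A f).obj T).obj (Simp.mk Y y)) (f.app (op n) x) ≫
          ((simpMap f).ranCounit.app T).app (Simp.mk X x) := Pi.lift_π _ _
  have hk (y : Y.obj (op n)) (s : Fibre f (Simp.mk Y y)) :
      k y ≫ ((pushforward A f).obj T).map s.hom ≫ ((simpMap f).ranCounit.app T).app s.simp =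
        Pi.π (fun x : X.obj (op n) ↦ T.obj (Simp.mk X x)) s.1 := by
    rw [← pushforwardObjIso_hom_π]
    refine (Category.assoc _ _ _).trans ?_
    exact (congrArg (_ ≫ ·) (Iso.inv_hom_id_assoc _ _)).trans (Pi.lift_π _ _)
  refine ⟨Pi.lift k, ?_, ?_⟩
  · refine Pi.hom_ext _ _ fun y ↦ ?_
    refine (Category.assoc _ _ _).trans ?_
    rw [Pi.lift_π]
    refine Eq.trans ?_ (Category.id_comp _).symm
    rw [← cancel_mono (pushforwardObjIso f T (Simp.mk Y y)).hom]
    refine Pi.hom_ext _ _ fun s ↦ ?_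
    rw [Category.assoc, Category.assoc, Category.assoc, pushforwardObjIso_hom_π, hk]
    refine (hπ s.1).trans ?_
    refine Eq.trans ?_ (Category.assoc _ _ _)
    -- The factors at `f s` and at `y` agree only through the equation `s.2`; `s.hom` is the arrow
    -- that identifies them.
    refine Eq.trans ?_ (congrArg (· ≫ ((simpMap f).ranCounit.app T).app s.simp)
      (π_map_congr ⟨Y, (pushforward A f).obj T⟩ s.2 (𝟙 _) s.hom rfl))
    refine congrArg (· ≫ ((simpMap f).ranCounit.app T).app s.simp) ?_
    exact ((congrArg (_ ≫ ·) (CategoryTheory.Functor.map_id _ _)).trans (Category.comp_id _)).symm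
  · refine Pi.hom_ext _ _ fun x ↦ ?_
    refine (Category.assoc _ _ _).trans ?_
    rw [hπ x]
    refine (Pi.lift_π_assoc _ _ _).trans ?_
    refine Eq.trans ?_ ((hk (f.app (op n) x) ⟨x, rfl⟩).trans (Category.id_comp _).symm)
    -- For the tautological point `⟨x, rfl⟩` of its own fibre, the identifying arrow is the
    -- identity.
    refine congrArg (k _ ≫ ·) ?_
    refine ((congrArg (· ≫ ((simpMap f).ranCounit.app T).app (Simp.mk X x))
      (((pushforward A f).obj T).map_id _)).trans (Category.id_comp _)).symm

instance {X Y : SSet.{u}} (f : X ⟶ Y) (T : Simp X ⥤ A) :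
    IsIso (cosimplicialFunctor.map (ofPushforward f T)) := by
  have (n : SimplexCategory) : IsIso ((cosimplicialFunctor.map (ofPushforward f T)).app n) :=
    inferInstanceAs (IsIso (mapAt (ofPushforward f T) n))
  exact NatIso.isIso_of_isIso_app _

/-- Since `∏ (y : Y_n), (f_* T)(y) ≅ ∏ (x : X_n), T x`, the natural systems `f_* T` and `T` have
isomorphic cohomology. -/
instance [Abelian A] {X Y : SSet.{u}} (f : X ⟶ Y) (T : Simp X ⥤ A) (n : ℕ) :
    IsIso ((cohomology n).map (ofPushforward f T)) := by
  have : IsIso (cochainComplex.map (ofPushforward f T)) :=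
    inferInstanceAs (IsIso ((AlgebraicTopology.alternatingCofaceMapComplex A).map
      (cosimplicialFunctor.map (ofPushforward f T))))
  exact inferInstanceAs (IsIso ((HomologicalComplex.homologyFunctor A _ n).map
    (cochainComplex.map (ofPushforward f T))))

end NatSys

end GabrielZisman

end

noncomputable section

namespace GabrielZisman

open Homological

/-! ### Base change -/

section BaseChange

variable {A : Type v} [Category.{w} A]

lemma eqToHom_restrict_app_app {X Y : SSet.{u}} {g g' : X ⟶ Y} (h : g = g') (P : Simp Y ⥤ A)
    (x : Simp X) :
    ((eqToHom (congrArg (fun g ↦ restrict A g) h)).app P).app x =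
      P.map (eqToHom (by rw [h])) := by
  subst h
  exact (P.map_id _).symm

variable [HasLimitsOfSize.{u, u} A]

/-- The base change transformation is compatible with the counits `f^* f_* ⟶ 𝟭`. -/
lemma baseChange_comp_ranCounit {X Y X' Y' : SSet.{u}} {f : X ⟶ Y} {f' : X' ⟶ Y'} {φ : X' ⟶ X}
    {ψ : Y' ⟶ Y} (h : φ ≫ f = f' ≫ ψ) (T : Simp X ⥤ A) (x : Simp X') :
    ((baseChange A h).app T).app ((simpMap f').obj x) ≫
        ((simpMap f').ranCounit.app ((restrict A φ).obj T)).app x =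
      ((pushforward A f).obj T).map (eqToHom (show (simpMap (f' ≫ ψ)).obj x =
        (simpMap (φ ≫ f)).obj x by rw [h])) ≫
        ((simpMap f).ranCounit.app T).app ((simpMap φ).obj x) := by
  -- The characteristic property of a mate with respect to the counits of the two adjunctions.
  have h₁ := NatTrans.congr_app (mateEquiv_counit ((simpMap f).ranAdjunction A)
    ((simpMap f').ranAdjunction A) (TwoSquare.mk _ _ _ _ (eqToHom (show restrict A ψ ⋙ restrict A f' =
      restrict A f ⋙ restrict A φ from congrArg (fun g ↦ restrict A g) h.symm))) T) x
  rw [Functor.ranAdjunction_counit, Functor.ranAdjunction_counit] at h₁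
  refine h₁.trans ?_
  exact congrArg (· ≫ ((simpMap f).ranCounit.app T).app ((simpMap φ).obj x))
    (eqToHom_restrict_app_app h.symm ((pushforward A f).obj T) x)

variable [Abelian A] [HasProducts.{u} A] [AB4StarOfSize.{u} A]

/-- Both sequences vanish in positive degrees, so only degree zero matters; there the condition
determines the map because `R'.zeroIso` is invertible. -/
lemma existsUnique_isSatelliteBaseChange {X Y X' Y' : SSet.{u}} {f : X ⟶ Y} {f' : X' ⟶ Y'}
    {φ : X' ⟶ X} {ψ : Y' ⟶ Y} (h : φ ≫ f = f' ≫ ψ) (R : RightSatellites (pushforward A f))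
    (R' : RightSatellites (pushforward A f')) :
    ∃! β, IsSatelliteBaseChange h R R' β := by
  have := ConnectedSequence.existsUnique_hom (R.seq.postcomp (restrict A ψ))
    (R'.seq.precomp (restrict A φ))
    (fun n ↦ Functor.isZero _ fun T ↦ Functor.isZero _ fun y ↦ ((R.isZero_succ n).obj T).obj _)
    (fun n ↦ Functor.isZero _ fun T ↦ (R'.isZero_succ n).obj _)
    ((Functor.whiskerRight R.zeroIso.hom (restrict A ψ) ≫ baseChange A h) ≫
      Functor.whiskerLeft (restrict A φ) R'.zeroIso.inv)
  exact (existsUnique_congr fun β ↦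
    (Functor.isoWhiskerLeft (restrict A φ) R'.zeroIso).eq_comp_inv).1 this

end BaseChange

/-! ### Comparison of the cohomology of `f_* T` and `T` -/

namespace MapSys

variable {A : Type v} [Category.{w} A] [Abelian A] [HasLimitsOfSize.{u, u} A]

/-- The morphism `(Y, R⁰f_* T) ⟶ (X, T)` given by `f` and the counit `f^* f_* T ⟶ T`. -/
def ofDirect (S : MapSys.{u} A) (R : RightSatellites (pushforward A S.f)) :
    S.direct R 0 ⟶ S.toNatSys :=
  (NatSys.isoMk S.Y (R.zeroIso.app S.T)).hom ≫ NatSys.ofPushforward S.f S.T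

/-- The diagram chase for `directMap_comp_ofDirect`, stated abstractly so that no object has to be
unfolded while rewriting. -/
lemma comp_eq_of_pasting {C : Type*} [Category C] {P P₁ P₂ P₃ P₄ P₅ P₆ P₇ P₈ Q : C}
    {b : P ⟶ P₁} {r : P₁ ⟶ P₂} {i₂ : P₂ ⟶ P₃} {c₃ : P₃ ⟶ Q} {i₁ : P₁ ⟶ P₄} {s : P₄ ⟶ P₃}
    {i₀ : P ⟶ P₅} {k : P₅ ⟶ P₄} {c₄ : P₄ ⟶ P₆} {t : P₆ ⟶ Q} {l : P₅ ⟶ P₇} {c₇ : P₇ ⟶ P₆}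
    {z : P ⟶ P₈} {i₈ : P₈ ⟶ P₇} (h₁ : b ≫ i₁ = i₀ ≫ k) (h₂ : k ≫ c₄ = l ≫ c₇)
    (h₃ : r ≫ i₂ = i₁ ≫ s) (h₄ : s ≫ c₃ = c₄ ≫ t) (h₅ : z ≫ i₈ = i₀ ≫ l) :
    (b ≫ r) ≫ i₂ ≫ c₃ = z ≫ (i₈ ≫ c₇) ≫ t := by
  rw [Category.assoc, Category.assoc, reassoc_of% h₃, reassoc_of% h₁, h₄, reassoc_of% h₂,
    reassoc_of% h₅]

/-- Naturality of the edge morphism before taking cohomology. At a simplex it is a pasting of the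
defining square of `β`, the compatibility of base change with counits, and naturality squares of the
counit and of the degree zero identifications. -/
lemma directMap_comp_ofDirect {S S' : MapSys.{u} A} (m : S ⟶ S')
    (R : RightSatellites (pushforward A S.f)) (R' : RightSatellites (pushforward A S'.f))
    (β : ConnectedSequence.Hom (R.seq.postcomp (restrict A m.ψ))
      (R'.seq.precomp (restrict A m.base.φ))) (hβ : IsSatelliteBaseChange m.w R R' β) :
    directMap m R R' β 0 ≫ S'.ofDirect R' = S.ofDirect R ≫ m.base := by
  refine NatSys.hom_ext m.w.symm fun x ↦ ?_
  -- The two ways around the square of simplicial maps agree only propositionally on `x`; `z`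
  -- bridges them.
  let z : (simpMap (S'.f ≫ m.ψ)).obj x ⟶ (simpMap (m.base.φ ≫ S.f)).obj x :=
    eqToHom (by rw [m.w])
  let y := (simpMap S'.f).obj x
  have h₁ : ((β.app 0).app S.T).app y ≫ (R'.zeroIso.hom.app ((restrict A m.base.φ).obj S.T)).app y =
      (R.zeroIso.hom.app S.T).app ((simpMap m.ψ).obj y) ≫ ((baseChange A m.w).app S.T).app y :=
    NatTrans.congr_app (NatTrans.congr_app hβ S.T) y
  have h₂ := baseChange_comp_ranCounit m.w S.T x
  have h₃ : ((R'.seq.obj 0).map m.base.τ).app y ≫ (R'.zeroIso.hom.app S'.T).app y =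
      (R'.zeroIso.hom.app ((restrict A m.base.φ).obj S.T)).app y ≫
        ((pushforward A S'.f).map m.base.τ).app y :=
    NatTrans.congr_app (R'.zeroIso.hom.naturality m.base.τ) y
  have h₄ : ((pushforward A S'.f).map m.base.τ).app y ≫
      ((simpMap S'.f).ranCounit.app S'.T).app x =
        ((simpMap S'.f).ranCounit.app ((restrict A m.base.φ).obj S.T)).app x ≫ m.base.τ.app x :=
    NatTrans.congr_app ((simpMap S'.f).ranCounit.naturality m.base.τ) x
  have h₅ := (R.zeroIso.hom.app S.T).naturality z
  exact comp_eq_of_pasting h₁ h₂ h₃ h₄ h₅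

variable [HasProducts.{u} A]

instance (S : MapSys.{u} A) (R : RightSatellites (pushforward A S.f)) (n : ℕ) :
    IsIso ((NatSys.cohomology n).map (S.ofDirect R)) := by
  have : IsIso ((NatSys.cohomology n).map ((NatSys.isoMk S.Y (R.zeroIso.app S.T)).hom ≫
      NatSys.ofPushforward S.f S.T)) := by
    rw [Functor.map_comp]
    infer_instance
  exact this

/-- The isomorphism `H_GZ^p(X, T) ≅ H_GZ^p(Y, R⁰f_* T)`. -/
def cohomologyDirectIso (S : MapSys.{u} A) (R : RightSatellites (pushforward A S.f)) (p : ℕ) :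
    (NatSys.cohomology p).obj S.toNatSys ≅ (NatSys.cohomology p).obj (S.direct R 0) :=
  (asIso ((NatSys.cohomology p).map (S.ofDirect R))).symm

lemma cohomologyDirectIso_naturality {S S' : MapSys.{u} A} (m : S ⟶ S')
    (R : RightSatellites (pushforward A S.f)) (R' : RightSatellites (pushforward A S'.f))
    (β : ConnectedSequence.Hom (R.seq.postcomp (restrict A m.ψ))
      (R'.seq.precomp (restrict A m.base.φ))) (hβ : IsSatelliteBaseChange m.w R R' β) (p : ℕ) :
    (NatSys.cohomology p).map m.base ≫ (S'.cohomologyDirectIso R' p).hom =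
      (S.cohomologyDirectIso R p).hom ≫ (NatSys.cohomology p).map (directMap m R R' β 0) := by
  refine (IsIso.comp_inv_eq _).2 ?_
  rw [Category.assoc, ← Functor.map_comp, directMap_comp_ofDirect m R R' β hβ, Functor.map_comp]
  exact (IsIso.inv_hom_id_assoc _ _).symm

end MapSys

end GabrielZisman

end

open Homological GabrielZisman

theorem mainTheorem1 (A : Type v) [Category.{w} A] [Abelian A] [HasLimitsOfSize.{u, u} A]
    [AB4StarOfSize.{u} A] :
    (∀ ⦃X Y : SSet.{u}⦄ (f : X ⟶ Y), Nonempty (RightSatellites (pushforward A f))) ∧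
    ∀ R : (∀ ⦃X Y : SSet.{u}⦄ (f : X ⟶ Y), RightSatellites (pushforward A f)),
      (∀ ⦃X Y X' Y' : SSet.{u}⦄ (f : X ⟶ Y) (f' : X' ⟶ Y') (φ : X' ⟶ X) (ψ : Y' ⟶ Y)
        (h : φ ≫ f = f' ≫ ψ), ∃! β, IsSatelliteBaseChange h (R f) (R f') β) ∧
      ∃ E : MapSys.{u} A ⥤ E₂CohomologicalSpectralSequenceNat A,
        Nonempty (Convergence E (fun n ↦ MapSys.source ⋙ NatSys.cohomology n)) ∧
        ∃ e : ∀ (S : MapSys.{u} A) (p q : ℕ),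
            ((E.obj S).page 2).X (p, q) ≅ (NatSys.cohomology p).obj (S.direct (R S.f) q),
          ∀ ⦃S S' : MapSys.{u} A⦄ (m : S ⟶ S') (β), IsSatelliteBaseChange m.w (R S.f) (R S'.f) β →
            ∀ p q : ℕ, ((E.map m).hom 2).f (p, q) ≫ (e S' p q).hom =
              (e S p q).hom ≫
                (NatSys.cohomology p).map (MapSys.directMap m (R S.f) (R S'.f) β q) := by
  -- The same functors serve as the row `q = 0` and as the abutment.
  let H (n : ℕ) : MapSys.{u} A ⥤ A := MapSys.source ⋙ NatSys.cohomology n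
  refine ⟨fun X Y f ↦ ⟨RightSatellites.ofPreservesEpimorphisms _⟩, fun R ↦
    ⟨fun X Y X' Y' f f' φ ψ h ↦ existsUnique_isSatelliteBaseChange h _ _,
      rowSpectralSequence H, ⟨rowConvergence H⟩, ?_⟩⟩
  have hR (S : MapSys.{u} A) (p q : ℕ) :
      IsZero ((NatSys.cohomology p).obj (S.direct (R S.f) (q + 1))) :=
    NatSys.isZero_cohomology _ (((R S.f).isZero_succ q).obj S.T) p
  -- Row zero uses the inverse of the edge isomorphism; in the other rows both sides are zero, and
  -- so is every obstruction to naturality.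
  refine ⟨fun S p q ↦ Nat.casesOn q
    (S.cohomologyDirectIso (R S.f) p)
    fun q ↦ ((isZero_rowEntry H p q).obj S).iso (hR S p q), fun S S' m β hβ p q ↦ ?_⟩
  cases q with
  | zero => exact MapSys.cohomologyDirectIso_naturality m (R S.f) (R S'.f) β hβ p
  | succ q => exact (hR S' p q).eq_of_tgt _ _
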